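/- Let $K$ be a number of arms. Let $\mathcal{Q}$ be either the set of all Bernoulli distributions (means in $[0,1]$) or the set of all Gaussian distributions with a fixed known variance $\sigma^2>0$ (means in $\mathbb{R}$), and let $\mathcal{P}\subset\mathcal{Q}$ be the subset of those whose mean lies in a given (arbitrary) set $\Theta$ of possible means. For $\boldsymbol{P}=(P_1,\dots,P_K)\in\mathcal{P}^K$ let $\mathcal{I}^*(\boldsymbol{P})\subset[K]$ be the set of arms $i$ for which $P_i$ has the largest mean. Let $H:\mathcal{P}^K\to(0,\infty]$ be any function. An algorithm $\pi_T$ with budget $T$ chooses in each round $t=1,\dots,T$ an arm $I(t)\in[K]$, possibly at random, on the basis of the arms drawn and the rewards observed so far, and receives a reward $X(t)$ drawn from $P_{I(t)}$ independently of the past; after round $T$ it outputs, possibly at random, an arm $J(T)\in[K]$ on the basis of the whole history. For a sequence $\{\pi_T\}_{T\ge 1}$ of such algorithms define the worst-case normalized rate of the probability of error by $$R(\{\pi_T\})=\inf_{\boldsymbol{P}\in\mathcal{P}^K} H(\boldsymbol{P})\,\liminf_{T\to\infty}\frac1T\log\frac{1}{\mathbb{P}_{\boldsymbol{P}}[J(T)\notin\mathcal{I}^*(\boldsymbol{P})]}\in[0,\infty].$$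 Let $D(Q\Vert P)=\mathbb{E}_{X\sim Q}\big[\log\frac{\mathrm{d}Q}{\mathrm{d}P}(X)\big]\in[0,\infty]$ denote the Kullback–Leibler divergence ($=\infty$ if $Q\not\ll P$), let $\Delta_K$ be the probability simplex in $\mathbb{R}^K$, and define $$R^{\mathrm{go}}=\sup_{\boldsymbol{r}:\mathcal{Q}^K\to\Delta_K,\ J:\mathcal{Q}^K\to[K]}\ \inf_{\boldsymbol{Q}\in\mathcal{Q}^K}\ \inf_{\boldsymbol{P}\in\mathcal{P}^K:\,J(\boldsymbol{Q})\notin\mathcal{I}^*(\boldsymbol{P})} H(\boldsymbol{P})\sum_{i\in[K]}r_i(\boldsymbol{Q})\,D(Q_i\Vert P_i),$$ where the supremum is over all functions $\boldsymbol{r}$ and $J$, and infima over the empty set are $\infty$. In the inner sum $0\cdot\infty=0$, and $\log(1/0)=\infty$; the product of $H(\boldsymbol{P})=\infty$ with $0$ may be given any fixed value $c\in[0,\infty]$, the same in both definitions. Then, for every sequence of algorithms $\{\pi_T\}$ (and every such $c$), $$R(\{\pi_T\})\le R^{\mathrm{go}}.$$ -/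

import Mathlib

open MeasureTheory ProbabilityTheory Filter
open scoped ENNReal NNReal unitInterval

noncomputable section

namespace FixedBudgetBAI

/-- The parametric reward models: Bernoulli rewards, or Gaussian rewards with a known
variance `v > 0`. -/
inductive RewardModel : Type
  | bernoulli : RewardModel
  | gaussian (v : ℝ≥0) (hv : 0 < v) : RewardModel

/-- The set of all possible means in a model: `[0, 1]` for Bernoulli, `ℝ` for Gaussian. -/
def RewardModel.Mean : RewardModel → Type
  | .bernoulli => I
  | .gaussian _ _ => ℝ

/-- The reward distribution (on `ℝ`) with a given mean. A Bernoulli reward of mean `p` equals `1`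
with probability `p` and `0` with probability `1 - p`. -/
def RewardModel.law : (M : RewardModel) → M.Mean → Measure ℝ
  | .bernoulli => fun p : I => bernoulliMeasure (1 : ℝ) 0 p
  | .gaussian v _ => fun m : ℝ => gaussianReal m v

/-- The set of best arms: those whose reward distribution has the largest mean. -/
def bestArms {K : ℕ} (ν : Fin K → Measure ℝ) : Set (Fin K) :=
  {i | ∀ j, ∫ x, x ∂(ν j) ≤ ∫ x, x ∂(ν i)}

/-- The history of the first `t` rounds: the arm drawn and the reward received in each of them. -/
abbrev History (K t : ℕ) : Type := Fin t → Fin K × ℝ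

/-- A (possibly randomized) algorithm for `K` arms with budget `T`. After `t < T` rounds it draws
the next arm at random according to `draw t`, given the history so far (the components `draw t`
with `t ≥ T` are never used); after `T` rounds it recommends an arm according to `recommend`. -/
structure Algorithm (K T : ℕ) where
  draw : (t : ℕ) → Kernel (History K t) (Fin K)
  draw_markov : ∀ t, IsMarkovKernel (draw t)
  recommend : Kernel (History K T) (Fin K)
  recommend_markov : IsMarkovKernel recommend

/-- The kernel that produces a reward from the arm drawn: arm `i` has reward distribution `ν i`. -/
def rewardKernel {K : ℕ} (ν : Fin K → Measure ℝ) : Kernel (Fin K) ℝ :=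
  Kernel.ofFunOfCountable ν

/-- The law of the history of the first `t` rounds, when the algorithm `π` interacts with arms of
reward distributions `ν`: given the history `h` of `t` rounds, the next arm `i` is drawn from
`π.draw t h`, and then the next reward is drawn from `ν i`. -/
def Algorithm.historyLaw {K T : ℕ} (π : Algorithm K T) (ν : Fin K → Measure ℝ) :
    (t : ℕ) → Measure (History K t)
  | 0 => Measure.dirac (fun i => i.elim0)
  | t + 1 =>
    ((π.historyLaw ν t) ⊗ₘ ((π.draw t) ⊗ₖ ((rewardKernel ν).comap Prod.snd measurable_snd))).map
      (fun p => (Fin.snoc p.1 p.2 : History K (t + 1)))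

/-- The probability of error: the probability that the arm recommended after `T` rounds is not
a best arm. -/
def Algorithm.probError {K T : ℕ} (π : Algorithm K T) (ν : Fin K → Measure ℝ) : ℝ≥0∞ :=
  (Measure.bind (π.historyLaw ν T) π.recommend) (bestArms ν)ᶜ

/-- The exponential rate `liminf_{T → ∞} (1 / T) log (1 / PoE)` of the probability of error of a
sequence of algorithms. It lies in `[0, ∞]`, as `log (1 / PoE)` does. -/
def errorRate {K : ℕ} (π : (T : ℕ) → Algorithm K T) (ν : Fin K → Measure ℝ) : ℝ≥0∞ :=
  liminf (fun T : ℕ => (ENNReal.log (1 / (π T).probError ν)).toENNReal / (T : ℝ≥0∞)) atTop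

/-- The product `h * x` in `[0, ∞]`, with the value `c` for `∞ * 0` (and `0 * ∞ = 0`). -/
def mulConv (c h x : ℝ≥0∞) : ℝ≥0∞ :=
  open Classical in if h = ∞ ∧ x = 0 then c else h * x

variable {M : RewardModel} {K : ℕ}

/-- The tuple of reward distributions of a tuple of means. -/
def RewardModel.laws (M : RewardModel) (Q : Fin K → M.Mean) : Fin K → Measure ℝ :=
  fun i => M.law (Q i)

/-- The worst-case normalized rate of a sequence of algorithms, over all instances whose means
lie in `Θ`. -/
def worstCaseRate (c : ℝ≥0∞) (Θ : Set M.Mean) (H : (Fin K → Θ) → ℝ≥0∞)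
    (π : (T : ℕ) → Algorithm K T) : ℝ≥0∞ :=
  ⨅ P : Fin K → Θ, mulConv c (H P) (errorRate π (M.laws fun i => (P i : M.Mean)))

/-- The weighted divergence `∑ i, r i * D(Q i ‖ P i)`, with `0 * ∞ = 0`. -/
def weightedDiv (r : Fin K → ℝ) (ν μ : Fin K → Measure ℝ) : ℝ≥0∞ :=
  ∑ i, ENNReal.ofReal (r i) * InformationTheory.klDiv (ν i) (μ i)

/-- The rate of the best oracle: the supremum over all allocation maps `r` and recommendation maps
`J` of the empirical distributions `Q`, of the infimum over all `Q` and all instances `P` with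
means in `Θ` for which `J Q` is not a best arm. -/
def goRate (c : ℝ≥0∞) (Θ : Set M.Mean) (H : (Fin K → Θ) → ℝ≥0∞) : ℝ≥0∞ :=
  ⨆ (r : (Fin K → M.Mean) → stdSimplex ℝ (Fin K)) (J : (Fin K → M.Mean) → Fin K),
    ⨅ (Q : Fin K → M.Mean) (P : Fin K → Θ)
      (_ : J Q ∉ bestArms (M.laws fun i => (P i : M.Mean))),
      mulConv c (H P)
        (weightedDiv (r Q : Fin K → ℝ) (M.laws Q) (M.laws fun i => (P i : M.Mean)))

end FixedBudgetBAI

end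

/-!
The supremum defining the oracle rate is almost attained by what the algorithms themselves do on
`Q`, seen at the scale of fractions of the budget.

Fix a tuple `Q` and run the algorithms on it. The outcome of budget `T`, that is the vector of draw
fractions together with the recommended arm, lies in a compact set, so the laws of the outcomes have
a cluster point `(r, J)`: no neighbourhood of it has a probability tending to `0`
(`exists_clusterOutcome`). Let `P` be an instance for which `J` is not optimal, with all
`D(Q i ‖ P i)` finite. When the draw fractions are near `r`, the log-likelihood ratio of the history
is at most `T * (∑ i, r i * D(Q i ‖ P i) + δ)` up to an event of vanishing probability, since the
difference from its compensator is a martingale with bounded second moments of increments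
(`lintegral_sq_historySum_le`). Hence the event that the fractions are near `r` and `J` is
recommended, whose probability under `Q` stays bounded below for infinitely many `T`, has under `P`
a probability of at least a constant times `exp (-T * (∑ i, r i * D(Q i ‖ P i) + δ))`
(`outcomeLaw_le_probError`). It is contained in the event of an error, and the exponent is a lower
limit, so infinitely many `T` suffice: the error exponent is at most `∑ i, r i * D(Q i ‖ P i)`
(`exists_errorRate_le`).

An infinite divergence of an arm with `r i = 0` would escape this argument, since a sublinear number
of draws may reveal that the instance is not `Q`. Replacing `r` by `(1 - η) * r + η / K` makes the
weighted divergence infinite for such `P`, and loses only the factor `1 - η` for the others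
(`exists_mul_errorRate_le`). A multiplicative loss passes through the product with `H P`, whatever
its size, and `η` tends to `0`.
-/

namespace FixedBudgetBAI

/-! ### Log-likelihood ratios of the reward models -/

theorem memLp_bernoulliMeasure {f : ℝ → ℝ} (hf : Measurable f) (p : I) (q : ℝ≥0∞) :
    MemLp f q (bernoulliMeasure (1 : ℝ) 0 p) := by
  refine MemLp.of_bound hf.aestronglyMeasurable (max |f 1| |f 0|) ?_
  rw [bernoulliMeasure_def, ae_add_measure_iff]
  constructor <;> refine Measure.ae_smul_measure ?_ _ <;> rw [ae_dirac_eq] <;> simp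

theorem gaussianReal_eq_withDensity_gaussianReal (a b : ℝ) {v : ℝ≥0} (hv : v ≠ 0) :
    gaussianReal a v = (gaussianReal b v).withDensity
      (fun x => ENNReal.ofReal (Real.exp ((a - b) / v * x + (b ^ 2 - a ^ 2) / (2 * v)))) := by
  have hv' : (v : ℝ) ≠ 0 := by exact_mod_cast hv
  rw [gaussianReal_of_var_ne_zero a hv, gaussianReal_of_var_ne_zero b hv,
    ← withDensity_mul _ (measurable_gaussianPDF b v) (by fun_prop)]
  congr 1
  ext x
  rw [Pi.mul_apply, gaussianPDF_def, gaussianPDF_def,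
    ← ENNReal.ofReal_mul (gaussianPDFReal_nonneg b v x)]
  simp only [gaussianPDFReal, mul_assoc, ← Real.exp_add]
  congr 3
  field_simp
  ring

theorem llr_gaussianReal (a b : ℝ) {v : ℝ≥0} (hv : v ≠ 0) :
    llr (gaussianReal a v) (gaussianReal b v) =ᵐ[gaussianReal a v]
      fun x => (a - b) / v * x + (b ^ 2 - a ^ 2) / (2 * v) := by
  have hac : gaussianReal a v ≪ gaussianReal b v := by
    rw [gaussianReal_eq_withDensity_gaussianReal a b hv]
    exact withDensity_absolutelyContinuous _ _
  refine hac.ae_le ?_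
  have h := Measure.rnDeriv_withDensity (gaussianReal b v)
    (f := fun x => ENNReal.ofReal (Real.exp ((a - b) / v * x + (b ^ 2 - a ^ 2) / (2 * v))))
    (by fun_prop)
  rw [← gaussianReal_eq_withDensity_gaussianReal a b hv] at h
  filter_upwards [h] with x hx
  rw [llr, hx, ENNReal.toReal_ofReal (Real.exp_nonneg _), Real.log_exp]

instance isProbabilityMeasure_law (M : RewardModel) (m : M.Mean) :
    IsProbabilityMeasure (M.law m) := by
  cases M with
  | bernoulli =>
    exact ⟨bernoulliMeasure_apply_of_mem_of_mem (X := ℝ) m MeasurableSet.univ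
      (Set.mem_univ _) (Set.mem_univ _)⟩
  | gaussian v hv => exact instIsProbabilityMeasureGaussianReal m v

theorem memLp_llr_law (M : RewardModel) (a b : M.Mean) :
    MemLp (llr (M.law a) (M.law b)) 2 (M.law a) := by
  cases M with
  | bernoulli => exact memLp_bernoulliMeasure (measurable_llr _ _) a 2
  | gaussian v hv =>
    refine (memLp_congr_ae (llr_gaussianReal a b hv.ne')).2 ?_
    have := instIsProbabilityMeasureGaussianReal a v
    exact ((memLp_id_gaussianReal' 2 (by simp)).const_mul _).add (memLp_const _)

/-- Only an inequality: `llr` takes the junk value `0` where the density vanishes, so that its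
exponential is `1` there. An upper bound on `ν` is all that the change of measure needs. -/
theorem le_withDensity_exp_llr {α : Type*} [MeasurableSpace α] {μ ν : Measure α}
    [SigmaFinite μ] [SigmaFinite ν] (h : ν ≪ μ) :
    ν ≤ μ.withDensity (fun x => ENNReal.ofReal (Real.exp (llr ν μ x))) := by
  conv_lhs => rw [← Measure.withDensity_rnDeriv_eq ν μ h]
  refine withDensity_mono ?_
  filter_upwards [exp_llr ν μ, Measure.rnDeriv_lt_top ν μ] with x hx hx'
  rw [hx]
  split_ifs with h0
  · simp [h0]
  · rw [ENNReal.ofReal_toReal hx'.ne]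

/-! ### The law of the history -/

variable {K T : ℕ}

instance isMarkovKernel_rewardKernel (ν : Fin K → Measure ℝ) [∀ i, IsProbabilityMeasure (ν i)] :
    IsMarkovKernel (rewardKernel ν) :=
  ⟨fun i => inferInstanceAs (IsProbabilityMeasure (ν i))⟩

theorem measurable_snoc (t : ℕ) :
    Measurable (fun p : History K t × (Fin K × ℝ) => (Fin.snoc p.1 p.2 : History K (t + 1))) := by
  refine measurable_pi_lambda _ fun i => ?_
  refine Fin.lastCases ?_ (fun j => ?_) i
  · simpa using measurable_snd
  · simp only [Fin.snoc_castSucc]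
    exact (measurable_pi_apply j).comp measurable_fst

instance isProbabilityMeasure_historyLaw (π : Algorithm K T) (ν : Fin K → Measure ℝ)
    [∀ i, IsProbabilityMeasure (ν i)] (t : ℕ) : IsProbabilityMeasure (π.historyLaw ν t) := by
  induction t with
  | zero => exact Measure.dirac.isProbabilityMeasure
  | succ t ih =>
    have := π.draw_markov t
    exact Measure.isProbabilityMeasure_map (measurable_snoc t).aemeasurable

theorem lintegral_historyLaw_succ (π : Algorithm K T) (ν : Fin K → Measure ℝ)
    [∀ i, IsProbabilityMeasure (ν i)] (t : ℕ) {F : History K (t + 1) → ℝ≥0∞}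
    (hF : Measurable F) :
    ∫⁻ h, F h ∂(π.historyLaw ν (t + 1)) =
      ∫⁻ h, ∫⁻ i, ∫⁻ x, F (Fin.snoc h (i, x)) ∂(ν i) ∂(π.draw t h) ∂(π.historyLaw ν t) := by
  have := π.draw_markov t
  have hG := hF.comp (measurable_snoc (K := K) t)
  rw [Algorithm.historyLaw, lintegral_map hF (measurable_snoc t),
    Measure.lintegral_compProd (f := fun p => F (Fin.snoc p.1 p.2)) hG]
  refine lintegral_congr fun h => ?_
  rw [Kernel.lintegral_compProd _ _ _ (f := fun p => F (Fin.snoc h p))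
    (hG.comp measurable_prodMk_left)]
  rfl

/-- The sum of `w i x` over the rounds of a history, `i` being the arm drawn and `x` the reward. -/
noncomputable def historySum {t : ℕ} (w : Fin K → ℝ → ℝ) (h : History K t) : ℝ :=
  ∑ s, w (h s).1 (h s).2

theorem historySum_snoc {t : ℕ} (w : Fin K → ℝ → ℝ) (h : History K t) (i : Fin K) (x : ℝ) :
    historySum w (Fin.snoc h (i, x) : History K (t + 1)) = historySum w h + w i x := by
  simp [historySum, Fin.sum_univ_castSucc]

theorem measurable_historySum {t : ℕ} {w : Fin K → ℝ → ℝ} (hw : ∀ i, Measurable (w i)) :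
    Measurable (historySum (t := t) w) := by
  refine Finset.measurable_sum _ fun s _ => ?_
  exact (measurable_from_prod_countable_right hw : Measurable fun p : Fin K × ℝ => w p.1 p.2).comp
    (measurable_pi_apply s)

/-! ### Change of measure and concentration -/

/-- Change of measure: a bound `exp (g i)` on the likelihood ratio of each arm bounds the likelihood
ratio of the whole history by the exponential of the sum of `g`. The sampling rule contributes no
factor, because it is the same under both instances. -/
theorem lintegral_historyLaw_le (π : Algorithm K T) {ν μ : Fin K → Measure ℝ}
    [∀ i, IsProbabilityMeasure (ν i)] [∀ i, IsProbabilityMeasure (μ i)] {g : Fin K → ℝ → ℝ}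
    (hg : ∀ i, Measurable (g i))
    (hνμ : ∀ i, ν i ≤ (μ i).withDensity (fun x => ENNReal.ofReal (Real.exp (g i x)))) (t : ℕ)
    {F : History K t → ℝ≥0∞} (hF : Measurable F) :
    ∫⁻ h, F h ∂(π.historyLaw ν t) ≤
      ∫⁻ h, F h * ENNReal.ofReal (Real.exp (historySum g h)) ∂(π.historyLaw μ t) := by
  induction t with
  | zero => simp [Algorithm.historyLaw, historySum]
  | succ t ih =>
    have hE : ∀ t, Measurable fun h : History K t =>
        ENNReal.ofReal (Real.exp (historySum g h)) := fun t =>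
      (measurable_historySum hg).exp.ennreal_ofReal
    have hFs : ∀ (h : History K t) (i : Fin K),
        Measurable fun x => F (Fin.snoc h (i, x)) := fun h i =>
      (hF.comp (measurable_snoc t)).comp (measurable_prodMk_left.comp measurable_prodMk_left)
    have hFm : Measurable fun h : History K t =>
        ∫⁻ i, ∫⁻ x, F (Fin.snoc h (i, x)) ∂(ν i) ∂(π.draw t h) := by
      have := π.draw_markov t
      have h1 : Measurable fun p : History K t × Fin K =>
          ∫⁻ x, F (Fin.snoc p.1 (p.2, x)) ∂(rewardKernel ν p.2) := by
        have h2 : Measurable fun q : (History K t × Fin K) × ℝ =>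
            F (Fin.snoc q.1.1 (q.1.2, q.2)) :=
          (hF.comp (measurable_snoc t)).comp (by fun_prop :
            Measurable fun q : (History K t × Fin K) × ℝ => (q.1.1, (q.1.2, q.2)))
        exact h2.lintegral_kernel_prod_right' (κ := (rewardKernel ν).comap Prod.snd measurable_snd)
      exact h1.lintegral_kernel_prod_right' (κ := π.draw t)
    rw [lintegral_historyLaw_succ π ν t hF,
      lintegral_historyLaw_succ π μ t (F := fun h => F h * _) (hF.mul (hE _))]
    refine (ih hFm).trans (lintegral_mono fun h => ?_)
    rw [← lintegral_mul_const _ (measurable_of_countable _)]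
    refine lintegral_mono fun i => ?_
    calc (∫⁻ x, F (Fin.snoc h (i, x)) ∂(ν i)) * ENNReal.ofReal (Real.exp (historySum g h))
        ≤ (∫⁻ x, F (Fin.snoc h (i, x)) ∂((μ i).withDensity
            (fun x => ENNReal.ofReal (Real.exp (g i x))))) *
            ENNReal.ofReal (Real.exp (historySum g h)) := by
          gcongr
          exact hνμ i
      _ = _ := by
          rw [lintegral_withDensity_eq_lintegral_mul _ (hg i).exp.ennreal_ofReal (hFs h i),
            ← lintegral_mul_const _ ((hg i).exp.ennreal_ofReal.mul (hFs h i))]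
          refine lintegral_congr fun x => ?_
          rw [historySum_snoc, Real.exp_add, ENNReal.ofReal_mul (Real.exp_nonneg _), Pi.mul_apply]
          ring

/-- A sum of centred functions of the rewards is a martingale under any sampling rule; its
increments are orthogonal, so its second moment grows at most linearly. -/
theorem lintegral_sq_historySum_le (π : Algorithm K T) {ν : Fin K → Measure ℝ}
    [∀ i, IsProbabilityMeasure (ν i)] {w : Fin K → ℝ → ℝ} (hw : ∀ i, Measurable (w i))
    (hL : ∀ i, MemLp (w i) 2 (ν i)) (h0 : ∀ i, ∫ x, w i x ∂(ν i) = 0) {V : ℝ}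
    (hV : ∀ i, ∫ x, w i x ^ 2 ∂(ν i) ≤ V) (t : ℕ) :
    ∫⁻ h, ENNReal.ofReal (historySum w h ^ 2) ∂(π.historyLaw ν t) ≤ t * ENNReal.ofReal V := by
  induction t with
  | zero => simp [Algorithm.historyLaw, historySum]
  | succ t ih =>
    rw [lintegral_historyLaw_succ π ν t ((measurable_historySum hw).pow_const 2).ennreal_ofReal]
    have := π.draw_markov t
    calc _ ≤ ∫⁻ h, (ENNReal.ofReal (historySum w h ^ 2) + ENNReal.ofReal V)
            ∂(π.historyLaw ν t) := by
          refine lintegral_mono fun h => ?_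
          calc _ ≤ ∫⁻ _, (ENNReal.ofReal (historySum w h ^ 2) + ENNReal.ofReal V)
                ∂(π.draw t h) := by
                refine lintegral_mono fun i => ?_
                have h1 := (hL i).integrable one_le_two
                have h2 := (hL i).integrable_sq
                simp only [historySum_snoc]
                set m := historySum w h
                have hI : Integrable (fun x => m ^ 2 + 2 * m * w i x) (ν i) :=
                  (integrable_const _).add (h1.const_mul _)
                have hI2 : Integrable (fun x => m ^ 2 + 2 * m * w i x + w i x ^ 2) (ν i) :=
                  hI.add h2
                have he : ∀ x, (m + w i x) ^ 2 = m ^ 2 + 2 * m * w i x + w i x ^ 2 :=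
                  fun x => by ring
                simp only [he]
                rw [← ofReal_integral_eq_lintegral_ofReal hI2
                    (ae_of_all _ fun x => (sq_nonneg (m + w i x)).trans_eq (he x)),
                  integral_add hI h2, integral_add (integrable_const _) (h1.const_mul _),
                  integral_const_mul, h0]
                refine (ENNReal.ofReal_le_ofReal (q := m ^ 2 + V) ?_).trans
                  ENNReal.ofReal_add_le
                simpa using hV i
            _ = _ := by simp
      _ ≤ _ := by
          rw [lintegral_add_right _ measurable_const]
          simp only [lintegral_const, measure_univ, mul_one]
          push_cast
          rw [add_mul, one_mul]
          gcongr

theorem measure_historySum_ge_le (π : Algorithm K T) {ν : Fin K → Measure ℝ}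
    [∀ i, IsProbabilityMeasure (ν i)] {w : Fin K → ℝ → ℝ} (hw : ∀ i, Measurable (w i))
    (hL : ∀ i, MemLp (w i) 2 (ν i)) (h0 : ∀ i, ∫ x, w i x ∂(ν i) = 0) {V : ℝ}
    (hV : ∀ i, ∫ x, w i x ^ 2 ∂(ν i) ≤ V) (t : ℕ) {δ : ℝ} (hδ : 0 < δ) (ht : 0 < t) :
    π.historyLaw ν t {h | δ * t ≤ historySum w h} ≤ ENNReal.ofReal (V / (δ ^ 2 * t)) := by
  have ht' : (0 : ℝ) < t := by exact_mod_cast ht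
  have hpos : 0 < (δ * t) ^ 2 := by positivity
  have hm := mul_meas_ge_le_lintegral (μ := π.historyLaw ν t)
    ((measurable_historySum (t := t) hw).pow_const 2).ennreal_ofReal (ENNReal.ofReal ((δ * t) ^ 2))
  have hsub : {h | δ * t ≤ historySum w h} ⊆ {h : History K t |
      ENNReal.ofReal ((δ * t) ^ 2) ≤ ENNReal.ofReal (historySum w h ^ 2)} := by
    intro h hh
    have : δ * t ≤ historySum w h := hh
    refine ENNReal.ofReal_le_ofReal ?_
    gcongr
  have h3 := (mul_le_mul_right (measure_mono (μ := π.historyLaw ν t) hsub)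
    (ENNReal.ofReal ((δ * t) ^ 2))).trans (hm.trans (lintegral_sq_historySum_le π hw hL h0 hV t))
  rw [mul_comm, ← ENNReal.le_div_iff_mul_le (.inl (ENNReal.ofReal_pos.2 hpos).ne')
    (.inl ENNReal.ofReal_ne_top)] at h3
  refine h3.trans (le_of_eq ?_)
  rw [← ENNReal.ofReal_natCast, ← ENNReal.ofReal_mul ht'.le, ← ENNReal.ofReal_div_of_pos hpos]
  congr 1
  field_simp

/-! ### Draw fractions and recommended arms -/

/-- The fraction of the rounds of a history in which each arm was drawn. -/
noncomputable def drawFraction {t : ℕ} (h : History K t) : Fin K → ℝ :=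
  fun i => historySum (fun j _ => if j = i then 1 else 0) h / t

theorem measurable_drawFraction {t : ℕ} : Measurable (drawFraction (K := K) (t := t)) :=
  measurable_pi_lambda _ fun _ => (measurable_historySum fun _ => measurable_const).div_const _

theorem mul_sum_drawFraction_mul {t : ℕ} (ht : 0 < t) (h : History K t) (d : Fin K → ℝ) :
    t * ∑ i, drawFraction h i * d i = historySum (fun i _ => d i) h := by
  have ht' : (t : ℝ) ≠ 0 := by exact_mod_cast ht.ne'
  simp only [drawFraction, historySum, Finset.mul_sum]
  calc _ = ∑ i, ∑ s, (if (h s).1 = i then 1 else 0) * d i := by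
        refine Finset.sum_congr rfl fun i _ => ?_
        rw [Finset.sum_div, Finset.sum_mul, Finset.mul_sum]
        refine Finset.sum_congr rfl fun s _ => ?_
        field_simp
    _ = _ := by rw [Finset.sum_comm]; simp

theorem drawFraction_mem_stdSimplex {t : ℕ} (ht : 0 < t) (h : History K t) :
    drawFraction h ∈ stdSimplex ℝ (Fin K) := by
  refine ⟨fun i => div_nonneg (Finset.sum_nonneg fun s _ => by dsimp only; split_ifs <;> simp)
    t.cast_nonneg, ?_⟩
  have ht' : (t : ℝ) ≠ 0 := by exact_mod_cast ht.ne'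
  have := mul_sum_drawFraction_mul ht h fun _ => 1
  simp [historySum] at this
  simpa [ht'] using this

/-- The joint law of the draw fractions and the recommended arm. -/
noncomputable def Algorithm.outcomeLaw (π : Algorithm K T) (ν : Fin K → Measure ℝ) :
    Measure ((Fin K → ℝ) × Fin K) :=
  (π.historyLaw ν T ⊗ₘ π.recommend).map (Prod.map drawFraction id)

theorem probError_eq_lintegral (π : Algorithm K T) (μ : Fin K → Measure ℝ) :
    π.probError μ = ∫⁻ h, π.recommend h (bestArms μ)ᶜ ∂(π.historyLaw μ T) := by
  rw [Algorithm.probError, Measure.bind_apply MeasurableSet.of_discrete π.recommend.aemeasurable]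

theorem outcomeLaw_prod_singleton (π : Algorithm K T) (ν : Fin K → Measure ℝ)
    [∀ i, IsProbabilityMeasure (ν i)] {U : Set (Fin K → ℝ)} (hU : MeasurableSet U) (J : Fin K) :
    π.outcomeLaw ν (U ×ˢ {J}) =
      ∫⁻ h, (drawFraction ⁻¹' U).indicator (fun h => π.recommend h {J}) h
        ∂(π.historyLaw ν T) := by
  have := π.recommend_markov
  have hm := measurable_drawFraction (K := K) (t := T) hU
  rw [Algorithm.outcomeLaw, Measure.map_apply (measurable_drawFraction.prodMap measurable_id)
      (hU.prod (measurableSet_singleton J)), lintegral_indicator hm,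
    ← Measure.compProd_apply_prod hm (measurableSet_singleton J)]
  rfl

theorem eventually_outcomeLaw_stdSimplex_eq_one (π : (T : ℕ) → Algorithm K T)
    (ν : Fin K → Measure ℝ) [∀ i, IsProbabilityMeasure (ν i)] :
    ∀ᶠ T in atTop, (π T).outcomeLaw ν (stdSimplex ℝ (Fin K) ×ˢ Set.univ) = 1 := by
  filter_upwards [eventually_gt_atTop 0] with T hT
  have := (π T).recommend_markov
  rw [Algorithm.outcomeLaw, Measure.map_apply (measurable_drawFraction.prodMap measurable_id)
    ((isClosed_stdSimplex ℝ (Fin K)).measurableSet.prod MeasurableSet.univ)]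
  convert measure_univ (μ := (π T).historyLaw ν T ⊗ₘ (π T).recommend)
  exact Set.eq_univ_of_forall fun p => ⟨drawFraction_mem_stdSimplex hT p.1, trivial⟩

/-- Along any sequence of algorithms, some pair of an allocation and an arm is a cluster point of
the outcome laws: the probability of no neighbourhood of it tends to `0`. Otherwise every point of
the compact set of outcomes has a neighbourhood of vanishing probability, hence so has the whole
set, whose probability is `1`. -/
theorem exists_clusterOutcome (π : (T : ℕ) → Algorithm K T) (ν : Fin K → Measure ℝ)
    [∀ i, IsProbabilityMeasure (ν i)] :
    ∃ r ∈ stdSimplex ℝ (Fin K), ∃ J : Fin K, ∀ U : Set (Fin K → ℝ), IsOpen U → r ∈ U →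
      ∃ η : ℝ, 0 < η ∧ ∃ᶠ T in atTop, ENNReal.ofReal η ≤ (π T).outcomeLaw ν (U ×ˢ {J}) := by
  by_contra! hcon
  have key : Tendsto (fun T => (π T).outcomeLaw ν (stdSimplex ℝ (Fin K) ×ˢ Set.univ)) atTop
      (nhds 0) := by
    refine ((isCompact_stdSimplex ℝ (Fin K)).prod isCompact_univ).induction_on
      (p := fun s => Tendsto (fun T => (π T).outcomeLaw ν s) atTop (nhds 0)) (by simp) ?_ ?_ ?_
    · exact fun s t hst ht => tendsto_of_tendsto_of_tendsto_of_le_of_le tendsto_const_nhds ht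
        (fun _ => zero_le) (fun _ => measure_mono hst)
    · intro s t hs ht
      exact tendsto_of_tendsto_of_tendsto_of_le_of_le tendsto_const_nhds
        (by simpa using hs.add ht) (fun _ => zero_le) (fun _ => measure_union_le _ _)
    · rintro ⟨r, J⟩ ⟨hr, -⟩
      obtain ⟨U, hU, hrU, h⟩ := hcon r hr J
      refine ⟨U ×ˢ {J}, mem_nhdsWithin_of_mem_nhds
        ((hU.prod (isOpen_discrete {J})).mem_nhds ⟨hrU, Set.mem_singleton J⟩), ?_⟩
      rw [ENNReal.tendsto_nhds_zero]
      intro ε hε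
      obtain ⟨η, hη, hηε⟩ := ENNReal.lt_iff_exists_real_btwn.1 hε
      have hη' : 0 < η := ENNReal.ofReal_pos.1 hηε.1
      filter_upwards [h η hη'] with T hT
      exact hT.le.trans hηε.2.le
  have h1 := key.congr' (eventually_outcomeLaw_stdSimplex_eq_one π ν)
  exact zero_ne_one (tendsto_nhds_unique h1 tendsto_const_nhds)

/-! ### Bounds on the error exponent -/

/-- Transport of an outcome from the instance `ν` to the instance `μ`. Recommending the suboptimal
arm `J` after draws of fractions `x` with `∑ i, x i * D(ν i ‖ μ i) < c` is an error under `μ`, at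
the cost of the factor `exp (T * (c + δ))`, except for the event that the log-likelihood ratio
exceeds its compensator by `δ * T`, which Chebyshev's inequality controls. -/
theorem outcomeLaw_le_probError (π : Algorithm K T) {ν μ : Fin K → Measure ℝ}
    [∀ i, IsProbabilityMeasure (ν i)] [∀ i, IsProbabilityMeasure (μ i)]
    (hac : ∀ i, ν i ≪ μ i) (hL : ∀ i, MemLp (llr (ν i) (μ i)) 2 (ν i)) {V : ℝ}
    (hV : ∀ i, ∫ x, (llr (ν i) (μ i) x - ∫ y, llr (ν i) (μ i) y ∂(ν i)) ^ 2 ∂(ν i) ≤ V)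
    {J : Fin K} (hJ : J ∉ bestArms μ) (hT : 0 < T) (c : ℝ) {δ : ℝ} (hδ : 0 < δ) :
    π.outcomeLaw ν ({x | ∑ i, x i * ∫ y, llr (ν i) (μ i) y ∂(ν i) < c} ×ˢ {J}) ≤
      ENNReal.ofReal (Real.exp (T * (c + δ))) * π.probError μ +
        ENNReal.ofReal (V / (δ ^ 2 * T)) := by
  have hT' : (0 : ℝ) < T := by exact_mod_cast hT
  set d : Fin K → ℝ := fun i => ∫ y, llr (ν i) (μ i) y ∂(ν i) with hd
  set g : Fin K → ℝ → ℝ := fun i => llr (ν i) (μ i) with hg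
  set w : Fin K → ℝ → ℝ := fun i x => g i x - d i with hw
  set U : Set (Fin K → ℝ) := {x | ∑ i, x i * d i < c} with hU
  have hUm : MeasurableSet U := by
    refine measurableSet_lt ?_ measurable_const
    exact Finset.measurable_sum _ fun i _ => (measurable_pi_apply i).mul_const _
  have hgm : ∀ i, Measurable (g i) := fun i => measurable_llr _ _
  have hwm : ∀ i, Measurable (w i) := fun i => (hgm i).sub_const _
  have hwL : ∀ i, MemLp (w i) 2 (ν i) := fun i => (hL i).sub (memLp_const _)
  have hw0 : ∀ i, ∫ x, w i x ∂(ν i) = 0 := fun i => by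
    simp only [hw]
    rw [integral_sub ((hL i).integrable one_le_two) (integrable_const _)]
    simp [hd]
  have hrec : Measurable fun h => π.recommend h {J} :=
    π.recommend.measurable_coe (measurableSet_singleton J)
  set B : Set (History K T) := {h | δ * T ≤ historySum w h} with hB
  have hBm : MeasurableSet B := measurableSet_le measurable_const (measurable_historySum hwm)
  set A : Set (History K T) := drawFraction ⁻¹' U \ B with hA
  have hAm : MeasurableSet A := (measurable_drawFraction hUm).diff hBm
  -- On `A` the log-likelihood ratio of the whole history is at most `T * (c + δ)`.
  have hS : ∀ h ∈ A, historySum g h ≤ T * (c + δ) := by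
    rintro h ⟨h1, h2⟩
    have h1' : ∑ i, drawFraction h i * d i < c := h1
    have h2' : historySum w h < δ * T := not_le.1 h2
    have h3 : historySum g h = historySum w h + historySum (fun i _ => d i) h := by
      simp [historySum, hw]
    rw [h3, ← mul_sum_drawFraction_mul hT h d]
    nlinarith
  have := π.recommend_markov
  rw [outcomeLaw_prod_singleton π ν hUm]
  calc _ ≤ ∫⁻ h, (A.indicator (fun h => π.recommend h {J}) h + B.indicator 1 h)
          ∂(π.historyLaw ν T) := by
        refine lintegral_mono fun h => ?_
        by_cases hh : h ∈ B
        · calc _ ≤ π.recommend h {J} := Set.indicator_le_self _ (fun h => π.recommend h {J}) h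
            _ ≤ 1 := prob_le_one
            _ ≤ _ := by rw [Set.indicator_of_mem hh]; exact le_add_self
        · by_cases hu : h ∈ drawFraction ⁻¹' U
          · have : h ∈ A := ⟨hu, hh⟩
            simp [Set.indicator_of_mem hu, Set.indicator_of_mem this]
          · simp [Set.indicator_of_notMem hu]
    _ = ∫⁻ h, A.indicator (fun h => π.recommend h {J}) h ∂(π.historyLaw ν T) +
          π.historyLaw ν T B := by
        rw [lintegral_add_left (hrec.indicator hAm), lintegral_indicator_one hBm]
    _ ≤ _ := by
        refine add_le_add ?_ (measure_historySum_ge_le π hwm hwL hw0 hV T hδ hT)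
        refine (lintegral_historyLaw_le π hgm (fun i => le_withDensity_exp_llr (hac i)) T
          (hrec.indicator hAm)).trans ?_
        rw [probError_eq_lintegral, ← lintegral_const_mul _
          (π.recommend.measurable_coe MeasurableSet.of_discrete)]
        refine lintegral_mono fun h => ?_
        by_cases hh : h ∈ A
        · rw [Set.indicator_of_mem hh, mul_comm]
          gcongr
          · exact hS h hh
          · simpa using hJ
        · simp [Set.indicator_of_notMem hh]

/-- A lower bound `a * exp (-b)` on a probability of error turns into the upper bound
`(b - log a) / T` on the normalized exponent. -/
theorem log_inv_div_le {p : ℝ≥0∞} {a b : ℝ} (ha : 0 < a)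
    (h : ENNReal.ofReal a ≤ ENNReal.ofReal (Real.exp b) * p) (hT : 0 < T) :
    (ENNReal.log (1 / p)).toENNReal / (T : ℝ≥0∞) ≤
      ENNReal.ofReal ((b - Real.log a) / T) := by
  have hT' : (0 : ℝ) < T := by exact_mod_cast hT
  have hp : ENNReal.ofReal (Real.exp (Real.log a - b)) ≤ p := by
    rw [Real.exp_sub, Real.exp_log ha, ENNReal.ofReal_div_of_pos (Real.exp_pos b)]
    exact ENNReal.div_le_of_le_mul' h
  have h1 : 1 / p ≤ ENNReal.ofReal (Real.exp (b - Real.log a)) := by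
    rw [← neg_sub, Real.exp_neg, ENNReal.ofReal_inv_of_pos (Real.exp_pos _), one_div]
    exact ENNReal.inv_le_inv.2 hp
  have h2 : (ENNReal.log (1 / p)).toENNReal ≤ ENNReal.ofReal (b - Real.log a) := by
    refine (EReal.toENNReal_le_toENNReal (ENNReal.log_le_log h1)).trans ?_
    rw [ENNReal.log_ofReal_of_pos (Real.exp_pos _), Real.log_exp, EReal.toENNReal_of_ne_top
      (EReal.coe_ne_top _), EReal.toReal_coe]
  rw [ENNReal.ofReal_div_of_pos hT', ENNReal.ofReal_natCast]
  gcongr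

theorem errorRate_le_of_frequently (π : (T : ℕ) → Algorithm K T) {ν μ : Fin K → Measure ℝ}
    [∀ i, IsProbabilityMeasure (ν i)] [∀ i, IsProbabilityMeasure (μ i)]
    (hac : ∀ i, ν i ≪ μ i) (hL : ∀ i, MemLp (llr (ν i) (μ i)) 2 (ν i))
    {J : Fin K} (hJ : J ∉ bestArms μ) {c η : ℝ} (hη : 0 < η)
    (hf : ∃ᶠ T in atTop, ENNReal.ofReal η ≤ (π T).outcomeLaw ν
      ({x | ∑ i, x i * ∫ y, llr (ν i) (μ i) y ∂(ν i) < c} ×ˢ {J})) {δ : ℝ} (hδ : 0 < δ) :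
    errorRate π μ ≤ ENNReal.ofReal (c + 2 * δ) := by
  set V : ℝ := ∑ i, ∫ x, (llr (ν i) (μ i) x - ∫ y, llr (ν i) (μ i) y ∂(ν i)) ^ 2 ∂(ν i)
  have hV : ∀ i, ∫ x, (llr (ν i) (μ i) x - ∫ y, llr (ν i) (μ i) y ∂(ν i)) ^ 2 ∂(ν i) ≤ V :=
    fun i => Finset.single_le_sum (f := fun i =>
      ∫ x, (llr (ν i) (μ i) x - ∫ y, llr (ν i) (μ i) y ∂(ν i)) ^ 2 ∂(ν i))
      (fun j _ => integral_nonneg fun _ => sq_nonneg _) (Finset.mem_univ i)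
  have hlim1 : Tendsto (fun T : ℕ => V / (δ ^ 2 * T)) atTop (nhds 0) := by
    have := (tendsto_const_div_atTop_nhds_zero_nat (V / δ ^ 2))
    refine this.congr fun T => by rw [div_div]
  have hlim2 : Tendsto (fun T : ℕ => -Real.log (η / 2) / T) atTop (nhds 0) :=
    tendsto_const_div_atTop_nhds_zero_nat _
  refine liminf_le_of_frequently_le' ?_
  refine (hf.and_eventually ((eventually_gt_atTop 0).and
    ((hlim1.eventually_lt_const (half_pos hη)).and (hlim2.eventually_lt_const hδ)))).mono ?_
  rintro T ⟨h1, hT, h2, h3⟩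
  have hT' : (0 : ℝ) < T := by exact_mod_cast hT
  have h4 := h1.trans ((outcomeLaw_le_probError (π T) hac hL hV hJ hT c hδ).trans
    (add_le_add_right (ENNReal.ofReal_le_ofReal h2.le) _))
  have h5 : ENNReal.ofReal (η / 2) ≤
      ENNReal.ofReal (Real.exp (T * (c + δ))) * (π T).probError μ := by
    -- Half of the probability `η` absorbs the exceptional event.
    conv_lhs at h4 => rw [← add_halves η, ENNReal.ofReal_add (by positivity) (by positivity)]
    exact (ENNReal.add_le_add_iff_right ENNReal.ofReal_ne_top).1 h4
  refine (log_inv_div_le (half_pos hη) h5 hT).trans (ENNReal.ofReal_le_ofReal ?_)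
  rw [sub_div, mul_div_cancel_left₀ _ hT'.ne', sub_eq_add_neg, ← neg_div]
  linarith

/-- For each `Q`, a cluster outcome `(r, J)` of the algorithms run on `Q` bounds the error exponent
on all instances for which `J` is suboptimal and all divergences are finite. -/
theorem exists_errorRate_le (M : RewardModel) (π : (T : ℕ) → Algorithm K T)
    (Q : Fin K → M.Mean) :
    ∃ r ∈ stdSimplex ℝ (Fin K), ∃ J : Fin K, ∀ P : Fin K → M.Mean, J ∉ bestArms (M.laws P) →
      (∀ i, InformationTheory.klDiv (M.laws Q i) (M.laws P i) ≠ ∞) →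
      errorRate π (M.laws P) ≤ weightedDiv r (M.laws Q) (M.laws P) := by
  have hprob : ∀ P : Fin K → M.Mean, ∀ i, IsProbabilityMeasure (M.laws P i) :=
    fun P i => isProbabilityMeasure_law M (P i)
  obtain ⟨r, hr, J, h⟩ := exists_clusterOutcome π (M.laws Q)
  refine ⟨r, hr, J, fun P hJ hfin => ?_⟩
  have hac : ∀ i, M.laws Q i ≪ M.laws P i := fun i =>
    (InformationTheory.klDiv_ne_top_iff.1 (hfin i)).1
  have hL : ∀ i, MemLp (llr (M.laws Q i) (M.laws P i)) 2 (M.laws Q i) := fun i =>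
    memLp_llr_law M (Q i) (P i)
  set d : Fin K → ℝ := fun i => ∫ y, llr (M.laws Q i) (M.laws P i) y ∂(M.laws Q i) with hd
  have hkl : ∀ i, (InformationTheory.klDiv (M.laws Q i) (M.laws P i)).toReal = d i := fun i =>
    InformationTheory.toReal_klDiv_of_measure_eq (hac i) (by simp)
  have hd0 : ∀ i, 0 ≤ d i := fun i => hkl i ▸ ENNReal.toReal_nonneg
  have hw : weightedDiv r (M.laws Q) (M.laws P) = ENNReal.ofReal (∑ i, r i * d i) := by
    rw [weightedDiv, ENNReal.ofReal_sum_of_nonneg fun i _ => mul_nonneg (hr.1 i) (hd0 i)]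
    refine Finset.sum_congr rfl fun i _ => ?_
    rw [ENNReal.ofReal_mul (hr.1 i), ← hkl, ENNReal.ofReal_toReal (hfin i)]
  rw [hw]
  -- Apply the definition of a cluster outcome to the half-space `∑ i, x i * d i < c`.
  have hδ : ∀ δ : ℝ, 0 < δ → errorRate π (M.laws P) ≤
      ENNReal.ofReal ((∑ i, r i * d i) + δ + 2 * δ) := by
    intro δ hδ
    obtain ⟨η, hη, hf⟩ := h {x | ∑ i, x i * d i < (∑ i, r i * d i) + δ}
      (isOpen_lt (by fun_prop) continuous_const) (lt_add_of_pos_right _ hδ)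
    exact errorRate_le_of_frequently π hac hL hJ hη hf hδ
  have hlim : Tendsto (fun δ : ℝ => ENNReal.ofReal ((∑ i, r i * d i) + δ + 2 * δ))
      (nhdsWithin 0 (Set.Ioi 0)) (nhds (ENNReal.ofReal (∑ i, r i * d i))) := by
    refine ENNReal.tendsto_ofReal (tendsto_nhdsWithin_of_tendsto_nhds ?_)
    have : Continuous fun δ : ℝ => (∑ i, r i * d i) + δ + 2 * δ := by fun_prop
    simpa using this.tendsto 0
  exact ge_of_tendsto hlim (eventually_mem_nhdsWithin.mono fun δ => hδ δ)

/-! ### The comparison with the oracle -/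

/-- The factor `a ≤ 1` is harmless whatever the value `c` of `∞ * 0` is, and `a ≠ 0` guarantees
that `y = 0` only if `x = 0`. -/
theorem mul_mulConv_le {c h x y : ℝ≥0∞} {a : ℝ≥0∞} (ha0 : a ≠ 0) (ha1 : a ≤ 1)
    (hxy : a * x ≤ y) : a * mulConv c h x ≤ mulConv c h y := by
  unfold mulConv
  split_ifs with h1 h2 h2
  · exact mul_le_of_le_one_left (zero_le) ha1
  · rw [h1.1, ENNReal.top_mul fun hy => h2 ⟨h1.1, hy⟩]
    exact le_top
  · exact absurd ⟨h2.1, by simpa [ha0, h2.2] using hxy⟩ h1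
  · calc a * (h * x) = h * (a * x) := by ring
      _ ≤ h * y := by gcongr

/-- Mixing the allocation with a small multiple of the uniform one removes the finiteness
condition: an arm with `D(Q i ‖ P i) = ∞` then has positive weight, and the weighted divergence
is infinite. The price is the factor `1 - η`. -/
theorem exists_mul_errorRate_le (M : RewardModel) (π : (T : ℕ) → Algorithm K T)
    (Q : Fin K → M.Mean) {η : ℝ} (hη0 : 0 < η) (hη1 : η < 1) :
    ∃ r ∈ stdSimplex ℝ (Fin K), ∃ J : Fin K, ∀ P : Fin K → M.Mean, J ∉ bestArms (M.laws P) →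
      ENNReal.ofReal (1 - η) * errorRate π (M.laws P) ≤
        weightedDiv r (M.laws Q) (M.laws P) := by
  obtain ⟨r, hr, J, h⟩ := exists_errorRate_le M π Q
  have hK : (0 : ℝ) < K := by exact_mod_cast J.pos
  have hη1' : 0 < 1 - η := sub_pos.2 hη1
  refine ⟨fun i => (1 - η) * r i + η / K, ⟨fun i => ?_, ?_⟩, J, fun P hJ => ?_⟩
  · have := hr.1 i
    positivity
  · rw [Finset.sum_add_distrib, ← Finset.mul_sum, hr.2]
    simp
    field_simp
    ring
  · by_cases hfin : ∀ i, InformationTheory.klDiv (M.laws Q i) (M.laws P i) ≠ ∞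
    · refine (mul_le_mul_right (h P hJ hfin) _).trans ?_
      rw [weightedDiv, weightedDiv, Finset.mul_sum]
      refine Finset.sum_le_sum fun i _ => ?_
      rw [← mul_assoc, ← ENNReal.ofReal_mul hη1'.le]
      gcongr
      have : 0 < η / K := by positivity
      linarith
    · push Not at hfin
      obtain ⟨i, hi⟩ := hfin
      have hpos : 0 < (1 - η) * r i + η / K := by
        have := hr.1 i
        positivity
      have htop : weightedDiv (fun i => (1 - η) * r i + η / K) (M.laws Q) (M.laws P) = ∞ := by
        refine ENNReal.sum_eq_top.2 ⟨i, Finset.mem_univ i, ?_⟩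
        rw [hi, ENNReal.mul_top (ENNReal.ofReal_pos.2 hpos).ne']
      rw [htop]
      exact le_top

theorem mul_worstCaseRate_le_goRate {M : RewardModel} (Θ : Set M.Mean) (H : (Fin K → Θ) → ℝ≥0∞)
    (c : ℝ≥0∞) (π : (T : ℕ) → Algorithm K T) {η : ℝ} (hη0 : 0 < η) (hη1 : η < 1) :
    ENNReal.ofReal (1 - η) * worstCaseRate c Θ H π ≤ goRate c Θ H := by
  choose r hr J h using fun Q => exists_mul_errorRate_le M π Q hη0 hη1
  refine le_iSup₂_of_le (fun Q => ⟨r Q, hr Q⟩) J (le_iInf fun Q => le_iInf₂ fun P hJ => ?_)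
  refine (mul_le_mul_right (iInf_le _ P) _).trans ?_
  exact mul_mulConv_le (by simpa using hη1) (by simpa using hη0.le) (h Q _ hJ)

end FixedBudgetBAI

theorem mainTheorem2 {K : ℕ} (M : FixedBudgetBAI.RewardModel) (Θ : Set M.Mean)
    (H : (Fin K → Θ) → ℝ≥0∞) (hH : ∀ P, 0 < H P) (c : ℝ≥0∞)
    (π : (T : ℕ) → FixedBudgetBAI.Algorithm K T) :
    FixedBudgetBAI.worstCaseRate c Θ H π ≤ FixedBudgetBAI.goRate c Θ H := by
  have hlim : Tendsto (fun η : ℝ => ENNReal.ofReal (1 - η) *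
      FixedBudgetBAI.worstCaseRate c Θ H π) (nhdsWithin 0 (Set.Ioi 0))
      (nhds (FixedBudgetBAI.worstCaseRate c Θ H π)) := by
    have h1 : Tendsto (fun η : ℝ => ENNReal.ofReal (1 - η)) (nhdsWithin 0 (Set.Ioi 0))
        (nhds 1) := by
      have : Continuous fun η : ℝ => ENNReal.ofReal (1 - η) :=
        ENNReal.continuous_ofReal.comp (by fun_prop)
      simpa using tendsto_nhdsWithin_of_tendsto_nhds (this.tendsto 0)
    simpa using ENNReal.Tendsto.mul_const h1 (.inl one_ne_zero)
  refine le_of_tendsto hlim ?_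
  filter_upwards [Ioo_mem_nhdsGT (zero_lt_one' ℝ)] with η hη
  exact FixedBudgetBAI.mul_worstCaseRate_le_goRate Θ H c π hη.1 hη.2
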